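/- Consider the Engel group $M=\mathbb R^4$ with coordinates $q=(x_1,x_2,y,z)$ and the left-invariant sub-Lorentzian structure for which $X_1=\partial_{x_1}-\frac{x_2}{2}\partial_y$ and $X_2=\partial_{x_2}+\frac{x_1}{2}\partial_y+\frac{x_1^2+x_2^2}{2}\partial_z$ are orthogonal with $g(X_1,X_1)=-1$, $g(X_2,X_2)=1$. Parametrize the initial covectors with $H=\frac12(-h_1^2+h_2^2)=\frac12$, $h_2>0$ by $\lambda=(\theta,c,\alpha)\in C=\mathbb R^3$, where $h_1=\sinh\theta$, $h_2=\cosh\theta$, $h_3=c$, $h_4=\alpha$. The spacelike normal extremal with initial covector $\lambda$ is the solution of $$\dot\theta=-c,\quad \dot c=-\alpha\sinh\theta,\quad \dot\alpha=0,\quad \dot x_1=-\sinh\theta,\quad \dot x_2=\cosh\theta,\quad \dot y=\tfrac12(x_2\sinh\theta+x_1\cosh\theta),\quad \dot z=\tfrac12(x_1^2+x_2^2)\cosh\theta$$ with $(\theta,c,\alpha)(0)=\lambda$ and $q(0)=0$. Let $t_{\sup}(\lambda)\in(0,+\infty]$ be the supremum of the times up to which this solution exists, let $N=\{(\lambda,t)\mid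 \lambda\in C,\ 0<t<t_{\sup}(\lambda)\}$, and let $\mathrm{Exp}:N\to M$, $\mathrm{Exp}(\lambda,t)=q(t)$, be the exponential mapping. The symmetry $\varepsilon^1$ maps a trajectory $(\theta(s),c(s),\alpha)$, $s\in[0,t]$, of the first three equations to the trajectory $(\theta(t-s),-c(t-s),\alpha)$; correspondingly $\varepsilon^1(\lambda,t)=(\lambda^1,t)$ with $\lambda^1=(\theta(t),-c(t),\alpha)$, where $(\theta(t),c(t),\alpha)$ is the value at time $t$ of the solution that starts at $\lambda$. The corresponding Maxwell set is $$\mathrm{MAX}^1=\{(\lambda,t)\in N\mid \lambda^1\neq\lambda,\ \mathrm{Exp}(\lambda^1,t)=\mathrm{Exp}(\lambda,t)\}.$$ Put $E=\frac{c^2}{2}-\alpha\cosh\theta$, $C_3=\{\lambda\in C\mid \alpha>0,\ E>-\alpha\}$ and $N_3=\{(\lambda,t)\in N\mid \lambda\in C_3\}$. Then $$\mathrm{MAX}^1\cap N_3=\emptyset .$$ -/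

import Mathlib

namespace EngelSpacelike

/-- A point of the Engel group `M = ℝ⁴`, in the coordinates `(x₁, x₂, y, z)`. -/
@[ext]
structure Point where
  x₁ : ℝ
  x₂ : ℝ
  y : ℝ
  z : ℝ

/-- The set `C = T*_{q₀}M ∩ {H = 1/2, h₂ > 0}` of initial covectors of spacelike normal extremals,
in the coordinates `(θ, c, α) ∈ ℝ³` given by
`h₁ = sinh θ`, `h₂ = cosh θ`, `h₃ = c`, `h₄ = α`. -/
@[ext]
structure Covector where
  θ : ℝ
  c : ℝ
  α : ℝ

/-- The energy integral `E = h₃² / 2 - h₂ h₄` of the vertical subsystem. -/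
noncomputable def Covector.energy (l : Covector) : ℝ :=
  l.c ^ 2 / 2 - l.α * Real.cosh l.θ

/-- The invariant subset `C₃ = {α > 0, E > -α}` of `C`. -/
def C₃ : Set Covector := {l | 0 < l.α ∧ -l.α < l.energy}

/-- `γ` solves on `[0, T]` the vertical subsystem
`θ' = -c`, `c' = -α sinh θ`, `α' = 0`, with `γ 0 = l`. -/
structure IsVerticalSolution (l : Covector) (T : ℝ) (γ : ℝ → Covector) : Prop where
  init : γ 0 = l
  deriv_θ : ∀ t ∈ Set.Icc 0 T,
    HasDerivWithinAt (fun s => (γ s).θ) (-(γ t).c) (Set.Icc 0 T) t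
  deriv_c : ∀ t ∈ Set.Icc 0 T,
    HasDerivWithinAt (fun s => (γ s).c) (-((γ t).α * Real.sinh (γ t).θ)) (Set.Icc 0 T) t
  deriv_α : ∀ t ∈ Set.Icc 0 T,
    HasDerivWithinAt (fun s => (γ s).α) 0 (Set.Icc 0 T) t

/-- `(γ, q)` is on `[0, T]` the spacelike normal extremal with initial covector `l` that starts
at the origin: it solves the Hamiltonian system of the sub-Lorentzian Hamiltonian
`H = (-h₁² + h₂²) / 2` on the level surface `{H = 1/2, h₂ > 0}`. -/
structure IsExtremal (l : Covector) (T : ℝ) (γ : ℝ → Covector) (q : ℝ → Point) : Prop where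
  vertical : IsVerticalSolution l T γ
  init : q 0 = ⟨0, 0, 0, 0⟩
  deriv_x₁ : ∀ t ∈ Set.Icc 0 T,
    HasDerivWithinAt (fun s => (q s).x₁) (-Real.sinh (γ t).θ) (Set.Icc 0 T) t
  deriv_x₂ : ∀ t ∈ Set.Icc 0 T,
    HasDerivWithinAt (fun s => (q s).x₂) (Real.cosh (γ t).θ) (Set.Icc 0 T) t
  deriv_y : ∀ t ∈ Set.Icc 0 T,
    HasDerivWithinAt (fun s => (q s).y)
      (((q t).x₂ * Real.sinh (γ t).θ + (q t).x₁ * Real.cosh (γ t).θ) / 2) (Set.Icc 0 T) t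
  deriv_z : ∀ t ∈ Set.Icc 0 T,
    HasDerivWithinAt (fun s => (q s).z)
      (((q t).x₁ ^ 2 + (q t).x₂ ^ 2) / 2 * Real.cosh (γ t).θ) (Set.Icc 0 T) t

/-- The least upper bound `t_sup(l) ∈ (0, +∞]` of the times up to which the extremal with
initial covector `l` exists. -/
noncomputable def tSup (l : Covector) : EReal :=
  sSup {s | ∃ T : ℝ, 0 ≤ T ∧ s = (T : EReal) ∧ ∃ γ q, IsExtremal l T γ q}

/-- The domain `N = {(l, t) ∈ C × ℝ₊ | t ∈ (0, t_sup(l))}` of the exponential mapping. -/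
def N : Set (Covector × ℝ) := {ν | 0 < ν.2 ∧ (ν.2 : EReal) < tSup ν.1}

/-- `N₃ = {(l, t) ∈ C₃ × ℝ₊ | t ∈ (0, t_sup(l))}`. -/
def N₃ : Set (Covector × ℝ) := {ν | ν.1 ∈ C₃ ∧ 0 < ν.2 ∧ (ν.2 : EReal) < tSup ν.1}

open Classical in
/-- The exponential mapping `Exp(l, t) = q(t)`. The solution on `[0, t]` is unique; the value is
the origin if there is none, which does not happen on `N`. -/
noncomputable def Exp (l : Covector) (t : ℝ) : Point :=
  if h : ∃ q : ℝ → Point, ∃ γ, IsExtremal l t γ q then h.choose t else ⟨0, 0, 0, 0⟩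

open Classical in
/-- The flow `e^{t H_v}(l)` of the vertical part `H_v = -c ∂_θ - α sinh θ ∂_c` of the Hamiltonian
vector field. The solution on `[0, t]` is unique; the value is `l` if there is none, which does
not happen on `N`. -/
noncomputable def verticalFlow (l : Covector) (t : ℝ) : Covector :=
  if h : ∃ γ : ℝ → Covector, IsVerticalSolution l t γ then h.choose t else l

/-- The reflection `(θ, c, α) ↦ (θ, -c, α)` of `C`. It corresponds to the symmetry
`(θ(t), c(t), α) ↦ (θ(T - t), -c(T - t), α)` of trajectories of the vertical subsystem. -/
def reflection₁ (l : Covector) : Covector := ⟨l.θ, -l.c, l.α⟩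

/-- The covector `l¹` of `ε¹(l, t) = (l¹, t)`: the reflection of the end of the vertical
trajectory, that is, the initial point of the reflected trajectory. -/
noncomputable def ε₁ (l : Covector) (t : ℝ) : Covector := reflection₁ (verticalFlow l t)

/-- The Maxwell set `MAX¹` of the symmetry `ε¹`, in the preimage of the exponential mapping. -/
def MAX₁ : Set (Covector × ℝ) :=
  {ν | ν ∈ N ∧ ε₁ ν.1 ν.2 ≠ ν.1 ∧ Exp (ε₁ ν.1 ν.2) ν.2 = Exp ν.1 ν.2}

end EngelSpacelike

namespace EngelSpacelike

open Set

/-! On `C₃` the momentum `c` never vanishes, since `c²/2 = E + α cosh θ > α (cosh θ - 1) ≥ 0`, so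
its sign is constant along a trajectory (`c_mul_c_pos`). Put `u = x₂ sinh θ + x₁ cosh θ = 2y'`. Then
`u' = -c (x₂ cosh θ + x₁ sinh θ)`, and the bracket is positive because `|x₁| < x₂` (`cone`). Hence
`u`, and with it `y`, has the sign of `-c` (`c_mul_y_neg`). Reversing the trajectory flips the sign
of `c`, so the two endpoints have `y` of opposite signs and cannot coincide. -/

/-- A function on `[0, T]` that vanishes at `0` and has positive derivative inside is positive. -/
theorem pos_of_hasDerivWithinAt_pos {F f : ℝ → ℝ} {T : ℝ} (h0 : F 0 = 0)
    (hF : ∀ t ∈ Icc 0 T, HasDerivWithinAt F (f t) (Icc 0 T) t)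
    (hf : ∀ t ∈ Ioc 0 T, 0 < f t) : ∀ t ∈ Ioc 0 T, 0 < F t := by
  intro t ht
  have hmono : StrictMonoOn F (Icc 0 T) := by
    refine strictMonoOn_of_deriv_pos (convex_Icc 0 T)
      (fun s hs => (hF s hs).continuousWithinAt) fun s hs => ?_
    rw [interior_Icc] at hs
    rw [((hF s (Ioo_subset_Icc_self hs)).hasDerivAt (Icc_mem_nhds hs.1 hs.2)).deriv]
    exact hf s (Ioo_subset_Ioc_self hs)
  have := hmono ⟨le_rfl, ht.1.le.trans ht.2⟩ (Ioc_subset_Icc_self ht) ht.1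
  rwa [h0] at this

theorem eq_of_hasDerivWithinAt_zero {F : ℝ → ℝ} {T : ℝ} (hT : 0 < T)
    (hF : ∀ t ∈ Icc 0 T, HasDerivWithinAt F 0 (Icc 0 T) t) : ∀ t ∈ Icc 0 T, F t = F 0 :=
  constant_of_derivWithin_zero (fun t ht => (hF t ht).differentiableWithinAt) fun t ht =>
    (hF t (Ico_subset_Icc_self ht)).derivWithin
      (uniqueDiffOn_Icc hT t (Ico_subset_Icc_self ht))

/-- A continuous function on `[0, T]` has a primitive that vanishes at `0`. -/
theorem exists_primitive {f : ℝ → ℝ} {T : ℝ} (hT : 0 ≤ T) (hf : ContinuousOn f (Icc 0 T)) :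
    ∃ F : ℝ → ℝ, F 0 = 0 ∧ ∀ t ∈ Icc 0 T, HasDerivWithinAt F (f t) (Icc 0 T) t := by
  -- Extending `f` by constants makes it continuous on `ℝ`, so the two-sided fundamental theorem of
  -- calculus applies even at the endpoints.
  have hg : Continuous (IccExtend hT ((Icc 0 T).domRestrict f)) :=
    (continuousOn_iff_continuous_domRestrict.1 hf).Icc_extend'
  refine ⟨fun t => ∫ s in (0 : ℝ)..t, IccExtend hT ((Icc 0 T).domRestrict f) s,
    intervalIntegral.integral_same, fun t ht => ?_⟩
  have := (hg.integral_hasStrictDerivAt 0 t).hasDerivAt.hasDerivWithinAt (s := Icc 0 T)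
  rwa [IccExtend_of_mem hT _ ht] at this

namespace IsVerticalSolution

variable {l : Covector} {T : ℝ} {γ : ℝ → Covector}

theorem mono {S : ℝ} (h : IsVerticalSolution l T γ) (hS : S ≤ T) : IsVerticalSolution l S γ :=
  have hsub : Icc 0 S ⊆ Icc 0 T := Icc_subset_Icc_right hS
  ⟨h.init, fun t ht => (h.deriv_θ t (hsub ht)).mono hsub,
    fun t ht => (h.deriv_c t (hsub ht)).mono hsub, fun t ht => (h.deriv_α t (hsub ht)).mono hsub⟩

theorem α_eq (h : IsVerticalSolution l T γ) (hT : 0 < T) : ∀ t ∈ Icc 0 T, (γ t).α = l.α := by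
  intro t ht
  rw [eq_of_hasDerivWithinAt_zero hT h.deriv_α t ht, h.init]

theorem energy_eq (h : IsVerticalSolution l T γ) (hT : 0 < T) :
    ∀ t ∈ Icc 0 T, (γ t).energy = l.energy := by
  intro t ht
  rw [eq_of_hasDerivWithinAt_zero (F := fun s => (γ s).energy) hT (fun s hs => ?_) t ht, h.init]
  have := (((h.deriv_c s hs).pow 2).div_const 2).sub
    ((h.deriv_α s hs).mul (h.deriv_θ s hs).cosh)
  refine this.congr_deriv ?_
  simp only [Nat.cast_ofNat, Nat.add_one_sub_one, pow_one]
  ring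

theorem mem_C₃ (h : IsVerticalSolution l T γ) (hT : 0 < T) (hl : l ∈ C₃) :
    ∀ t ∈ Icc 0 T, γ t ∈ C₃ := by
  intro t ht
  simpa only [C₃, mem_ofPred_eq, h.α_eq hT t ht, h.energy_eq hT t ht] using hl

/-- The time reversal of a vertical solution starts at the reflection of its end. -/
theorem reverse (h : IsVerticalSolution l T γ) :
    IsVerticalSolution (reflection₁ (γ T)) T (fun s => reflection₁ (γ (T - s))) := by
  have hmaps : MapsTo (fun s => T - s) (Icc 0 T) (Icc 0 T) :=
    fun s hs => ⟨sub_nonneg.2 hs.2, sub_le_self _ hs.1⟩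
  have hr : ∀ t, HasDerivWithinAt (fun s => T - s) (-1) (Icc 0 T) t := fun t =>
    ((hasDerivAt_id t).const_sub T).hasDerivWithinAt
  refine ⟨by simp, fun t ht => ?_, fun t ht => ?_, fun t ht => ?_⟩
  · exact ((h.deriv_θ _ (hmaps ht)).comp t (hr t) hmaps).congr_deriv (by simp [reflection₁])
  · exact ((h.deriv_c _ (hmaps ht)).comp t (hr t) hmaps).neg.congr_deriv (by simp [reflection₁])
  · exact ((h.deriv_α _ (hmaps ht)).comp t (hr t) hmaps).congr_deriv (by simp)

/-- Every vertical solution lifts to an extremal. -/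
theorem exists_isExtremal (h : IsVerticalSolution l T γ) (hT : 0 ≤ T) :
    ∃ q, IsExtremal l T γ q := by
  have hθ : ContinuousOn (fun s => (γ s).θ) (Icc 0 T) :=
    fun t ht => (h.deriv_θ t ht).continuousWithinAt
  have hsinh := Real.continuous_sinh.comp_continuousOn hθ
  have hcosh := Real.continuous_cosh.comp_continuousOn hθ
  -- The position equations are triangular: `x₁`, `x₂` are integrals in `θ` alone, then `y`, `z` in
  -- `θ`, `x₁`, `x₂`.
  obtain ⟨x₁, hx₁, dx₁⟩ := exists_primitive hT hsinh.neg
  obtain ⟨x₂, hx₂, dx₂⟩ := exists_primitive hT hcosh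
  have cx₁ : ContinuousOn x₁ (Icc 0 T) := fun t ht => (dx₁ t ht).continuousWithinAt
  have cx₂ : ContinuousOn x₂ (Icc 0 T) := fun t ht => (dx₂ t ht).continuousWithinAt
  obtain ⟨y, hy, dy⟩ := exists_primitive hT (((cx₂.mul hsinh).add (cx₁.mul hcosh)).div_const 2)
  obtain ⟨z, hz, dz⟩ :=
    exists_primitive hT ((((cx₁.pow 2).add (cx₂.pow 2)).div_const 2).mul hcosh)
  exact ⟨fun s => ⟨x₁ s, x₂ s, y s, z s⟩, h, by simp only [hx₁, hx₂, hy, hz], dx₁, dx₂, dy, dz⟩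

end IsVerticalSolution

/-- `c = 0` would give `E = -α cosh θ ≤ -α`. -/
theorem c_ne_zero_of_mem_C₃ {l : Covector} (hl : l ∈ C₃) : l.c ≠ 0 := by
  intro hc
  obtain ⟨hα, hE⟩ := hl
  rw [Covector.energy, hc] at hE
  nlinarith [Real.one_le_cosh l.θ]

/-- The vertical momentum keeps its sign along a solution in `C₃`. -/
theorem IsVerticalSolution.c_mul_c_pos {l : Covector} {T : ℝ} {γ : ℝ → Covector}
    (h : IsVerticalSolution l T γ) (hT : 0 < T) (hl : l ∈ C₃) :
    ∀ t ∈ Icc 0 T, 0 < l.c * (γ t).c := by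
  intro t ht
  by_contra! hneg
  have hcont : ContinuousOn (fun s => l.c * (γ s).c) (Icc 0 t) := fun s hs =>
    ((h.deriv_c s ⟨hs.1, hs.2.trans ht.2⟩).continuousWithinAt.mono
      (Icc_subset_Icc_right ht.2)).const_mul l.c
  have h0 : 0 ≤ l.c * (γ 0).c := by rw [h.init]; exact mul_self_nonneg _
  obtain ⟨s, hs, hs0⟩ := intermediate_value_Icc' ht.1 hcont ⟨hneg, h0⟩
  exact mul_ne_zero (c_ne_zero_of_mem_C₃ hl)
    (c_ne_zero_of_mem_C₃ (h.mem_C₃ hT hl s ⟨hs.1, hs.2.trans ht.2⟩)) hs0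

namespace IsExtremal

variable {l : Covector} {T : ℝ} {γ : ℝ → Covector} {q : ℝ → Point}

theorem mono {S : ℝ} (h : IsExtremal l T γ q) (hS : S ≤ T) : IsExtremal l S γ q :=
  have hsub : Icc 0 S ⊆ Icc 0 T := Icc_subset_Icc_right hS
  ⟨h.vertical.mono hS, h.init, fun t ht => (h.deriv_x₁ t (hsub ht)).mono hsub,
    fun t ht => (h.deriv_x₂ t (hsub ht)).mono hsub, fun t ht => (h.deriv_y t (hsub ht)).mono hsub,
    fun t ht => (h.deriv_z t (hsub ht)).mono hsub⟩

/-- The projection of an extremal to the `(x₁, x₂)`-plane stays in the cone `|x₁| < x₂`. -/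
theorem cone (h : IsExtremal l T γ q) :
    ∀ t ∈ Ioc 0 T, 0 < (q t).x₂ + (q t).x₁ ∧ 0 < (q t).x₂ - (q t).x₁ := by
  intro t ht
  constructor
  · refine pos_of_hasDerivWithinAt_pos (F := fun s => (q s).x₂ + (q s).x₁) (by simp [h.init])
      (fun s hs => (h.deriv_x₂ s hs).add (h.deriv_x₁ s hs)) (fun s _ => ?_) t ht
    rw [← sub_eq_add_neg, Real.cosh_sub_sinh]
    exact Real.exp_pos _
  · refine pos_of_hasDerivWithinAt_pos (F := fun s => (q s).x₂ - (q s).x₁) (by simp [h.init])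
      (fun s hs => (h.deriv_x₂ s hs).sub (h.deriv_x₁ s hs)) (fun s _ => ?_) t ht
    rw [sub_neg_eq_add, Real.cosh_add_sinh]
    exact Real.exp_pos _

/-- The coordinate `y` of an extremal in `C₃` has the sign opposite to that of `c`. -/
theorem c_mul_y_neg (h : IsExtremal l T γ q) (hT : 0 < T) (hl : l ∈ C₃) :
    l.c * (q T).y < 0 := by
  have hu : ∀ t ∈ Ioc 0 T, 0 < -l.c *
      ((q t).x₂ * Real.sinh (γ t).θ + (q t).x₁ * Real.cosh (γ t).θ) := by
    refine pos_of_hasDerivWithinAt_pos (f := fun t => l.c * (γ t).c *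
      ((q t).x₂ * Real.cosh (γ t).θ + (q t).x₁ * Real.sinh (γ t).θ))
      (by simp [h.init]) (fun t ht => ?_) fun t ht => ?_
    -- The products `sinh θ cosh θ` coming from `x₁'` and `x₂'` cancel.
    · have hθ := h.vertical.deriv_θ t ht
      refine ((((h.deriv_x₂ t ht).mul hθ.sinh).add
        ((h.deriv_x₁ t ht).mul hθ.cosh)).const_mul (-l.c)).congr_deriv ?_
      ring
    · refine mul_pos (h.vertical.c_mul_c_pos hT hl t (Ioc_subset_Icc_self ht)) ?_
      obtain ⟨h₁, h₂⟩ := h.cone t ht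
      -- In light-cone form, `2 (x₂ cosh θ + x₁ sinh θ) = (x₂ + x₁) e^θ + (x₂ - x₁) e^{-θ}`.
      have e₁ := mul_pos h₁ (Real.exp_pos (γ t).θ)
      have e₂ := mul_pos h₂ (Real.exp_pos (-(γ t).θ))
      rw [← Real.cosh_add_sinh] at e₁
      rw [← Real.cosh_sub_sinh] at e₂
      linarith
  have hy := pos_of_hasDerivWithinAt_pos (F := fun s => -l.c * (q s).y) (by simp [h.init])
    (fun t ht => (h.deriv_y t ht).const_mul (-l.c)) (fun t ht => by linarith [hu t ht])
    T ⟨hT, le_rfl⟩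
  linarith

end IsExtremal

theorem exists_isExtremal_of_lt_tSup {l : Covector} {t : ℝ} (h : (t : EReal) < tSup l) :
    ∃ γ q, IsExtremal l t γ q := by
  obtain ⟨_, ⟨T, -, rfl, γ, q, hq⟩, htT⟩ := lt_sSup_iff.1 h
  exact ⟨γ, q, hq.mono (EReal.coe_lt_coe_iff.1 htT).le⟩

/-- The sign results hold for every extremal, so it suffices that the value picked by choice comes
from some extremal; uniqueness is not needed. -/
theorem exists_isExtremal_Exp {l : Covector} {t : ℝ} (h : ∃ γ q, IsExtremal l t γ q) :
    ∃ γ q, IsExtremal l t γ q ∧ Exp l t = q t := by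
  have h' : ∃ q γ, IsExtremal l t γ q := let ⟨γ, q, hq⟩ := h; ⟨q, γ, hq⟩
  obtain ⟨γ, hγ⟩ := h'.choose_spec
  exact ⟨γ, h'.choose, hγ, by rw [Exp, dif_pos h']⟩

theorem exists_isVerticalSolution_verticalFlow {l : Covector} {t : ℝ}
    (h : ∃ γ, IsVerticalSolution l t γ) :
    ∃ γ, IsVerticalSolution l t γ ∧ verticalFlow l t = γ t :=
  ⟨h.choose, h.choose_spec, by rw [verticalFlow, dif_pos h]⟩

theorem reflection₁_mem_C₃ {l : Covector} (hl : l ∈ C₃) : reflection₁ l ∈ C₃ := by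
  simpa [C₃, Covector.energy, reflection₁] using hl

/-- The points `Exp(l, t)` and `Exp(l¹, t)` have `y`-coordinates of opposite signs. -/
theorem Exp_y_mul_Exp_ε₁_y_neg {l : Covector} {t : ℝ} (hl : l ∈ C₃) (ht : 0 < t)
    (hsup : (t : EReal) < tSup l) : (Exp l t).y * (Exp (ε₁ l t) t).y < 0 := by
  have hex := exists_isExtremal_of_lt_tSup hsup
  obtain ⟨γ₀, q₀, h₀, e₀⟩ := exists_isExtremal_Exp hex
  obtain ⟨γ, hγ, eγ⟩ := exists_isVerticalSolution_verticalFlow ⟨γ₀, h₀.vertical⟩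
  -- This extremal shows that `Exp` at the reflected covector is not the default origin.
  obtain ⟨p, hp⟩ := hγ.reverse.exists_isExtremal ht.le
  obtain ⟨γ₁, q₁, h₁, e₁⟩ := exists_isExtremal_Exp ⟨_, p, hp⟩
  have htt : t ∈ Set.Icc 0 t := ⟨ht.le, le_rfl⟩
  have y₀ := h₀.c_mul_y_neg ht hl
  have y₁ := h₁.c_mul_y_neg ht (reflection₁_mem_C₃ (hγ.mem_C₃ ht hl t htt))
  have hc := hγ.c_mul_c_pos ht hl t htt
  rw [ε₁, eγ, e₁, e₀]
  simp only [reflection₁, neg_mul, neg_lt_zero] at y₁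
  -- Regrouped, this product is `c(0) c(t)`, which is positive, times the product of the two
  -- `y`-coordinates.
  have := mul_neg_of_neg_of_pos y₀ y₁
  by_contra! hn
  nlinarith [mul_nonneg hc.le hn]

end EngelSpacelike

theorem mainTheorem11 : EngelSpacelike.MAX₁ ∩ EngelSpacelike.N₃ = ∅ := by
  refine Set.eq_empty_of_forall_notMem fun ⟨l, t⟩ h => ?_
  obtain ⟨⟨-, -, hExp⟩, hl, ht, hsup⟩ := h
  have hy := EngelSpacelike.Exp_y_mul_Exp_ε₁_y_neg hl ht hsup
  rw [hExp] at hy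
  exact absurd hy (mul_self_nonneg _).not_gt
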